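/- For a finite simple graph $G$, let $\rho(G)$ denote its spectral radius, i.e. the largest eigenvalue of its adjacency matrix; call $G$ irregular if its vertices do not all have the same degree. Let $\mathcal{F}(n,\Delta)$ be the set of connected irregular graphs on $n$ vertices with maximum degree $\Delta$, let $\mathcal{B}(n,\Delta)\subseteq\mathcal{F}(n,\Delta)$ be the subset of bipartite ones, and put $\rho(n,\Delta)=\max\{\rho(G):G\in\mathcal{F}(n,\Delta)\}$ and $\lambda(n,\Delta)=\max\{\rho(G):G\in\mathcal{B}(n,\Delta)\}$. Then the maximum $\lambda(n,3)$ exists for every $n\ge 4$, and $$\lim_{n\to\infty}n^{2}\bigl(3-\lambda(n,3)\bigr)=\pi^{2}.$$ Consequently the conjecture of Liu, Shen and Wang that, for each fixed $\Delta$, $\lim_{n\to\infty}\frac{n^{2}(\Delta-\rho(n,\Delta))}{\Delta-1}=\pi^{2}$ is false for $\Delta=3$, that is, $n^{2}(3-\rho(n,3))$ does not tend to $2\pi^{2}$. -/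

import Mathlib

/-- The spectral radius of a finite graph: the largest (real) eigenvalue of its adjacency matrix.
For a nonempty vertex set the spectrum of this symmetric matrix is finite and nonempty, so the
supremum is a maximum. -/
noncomputable def graphSpectralRadius {n : ℕ} (G : SimpleGraph (Fin n)) : ℝ :=
  open Classical in sSup (spectrum ℝ (G.adjMatrix ℝ))

/-- Connected irregular graphs on `n` (labelled) vertices with maximum degree `Δ`. -/
def irregularGraphs (n Δ : ℕ) : Set (SimpleGraph (Fin n)) :=
  open Classical in
  {G | G.Connected ∧ (¬ ∃ d : ℕ, G.IsRegularOfDegree d) ∧ G.maxDegree = Δ}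

/-- Connected irregular bipartite graphs on `n` (labelled) vertices with maximum degree `Δ`. -/
def irregularBipartiteGraphs (n Δ : ℕ) : Set (SimpleGraph (Fin n)) :=
  {G | G ∈ irregularGraphs n Δ ∧ G.IsBipartite}

/-- The maximum spectral radius over connected irregular graphs on `n` vertices with maximum
degree `Δ`. -/
noncomputable def maxIrregularRadius (n Δ : ℕ) : ℝ :=
  sSup (graphSpectralRadius '' irregularGraphs n Δ)

/-- The maximum spectral radius over connected irregular bipartite graphs on `n` vertices with
maximum degree `Δ`. -/
noncomputable def maxIrregularBipartiteRadius (n Δ : ℕ) : ℝ :=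
  sSup (graphSpectralRadius '' irregularBipartiteGraphs n Δ)

/-- The Liu–Shen–Wang conjecture for the fixed maximum degree `Δ`. -/
def LiuShenWangConjecture (Δ : ℕ) : Prop :=
  Filter.Tendsto
    (fun n : ℕ => (n : ℝ) ^ 2 * ((Δ : ℝ) - maxIrregularRadius n Δ) / ((Δ : ℝ) - 1))
    Filter.atTop (nhds (Real.pi ^ 2))

open Finset Filter Topology

/-! The limit is squeezed: every bipartite graph in the class has 3 - ρ ≥ 2 - 2cos(π/(n+2)), and one
explicit graph has 3 - ρ ≤ π²/(n-4)².

For the first bound, passing from x to |x| reduces matters to the form of 3I - A on nonnegative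
vectors. Sort the entries increasingly and write x as the sum of its increments g_k ≥ 0 times the
indicators of the nested upper sets T_k. The form becomes Σ g_k g_l Q(T_k, T_l) with integers Q, and
purely combinatorial arguments give Q ≥ 2 on the diagonal (`two_le_cutForm_self`, where
bipartiteness enters), Q ≥ 1 for consecutive sets (`one_le_cutForm_insert`) and Q ≥ 0 otherwise. The
resulting tridiagonal form is a sum of squares of g_k + g_{k+1} = x_{k+1} - x_{k-1} plus end terms:
the Dirichlet energy of two interleaved paths of about n/2 vertices, each pinned at one end and free
at the other. `interleaved_wirtinger` bounds it.

For the second bound, `cappedLadder` has layers of two vertices and behaves like a path of about n/2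
layers with the same boundary conditions, so a sine profile is a test vector (`ladder_test_vector`).
-/

/-! ### Summation by parts and a discrete Wirtinger inequality -/

theorem sum_mul_mul_eq_sum_tail {n : ℕ} (N : Fin n → Fin n → ℝ) (g x : Fin n → ℝ)
    (hx : ∀ i, x i = ∑ k, if k ≤ i then g k else 0) :
    ∑ i, ∑ j, N i j * (x i * x j) =
      ∑ k, ∑ l, g k * g l * ∑ i ∈ Ici k, ∑ j ∈ Ici l, N i j := by
  have hI : ∀ k : Fin n, Ici k = univ.filter (fun i => k ≤ i) := by
    intro k; ext i; simp
  have h1 : ∀ i j, N i j * (x i * x j) =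
      ∑ k, ∑ l, g k * g l * (if k ≤ i then (if l ≤ j then N i j else 0) else 0) := by
    intro i j
    rw [hx i, hx j, Finset.sum_mul_sum, Finset.mul_sum]
    refine Finset.sum_congr rfl fun k _ => ?_
    rw [Finset.mul_sum]
    refine Finset.sum_congr rfl fun l _ => ?_
    split_ifs <;> ring
  simp_rw [h1, hI, Finset.sum_filter]
  calc _ = ∑ i, ∑ k, ∑ l, ∑ j,
        g k * g l * (if k ≤ i then (if l ≤ j then N i j else 0) else 0) := by
        refine Finset.sum_congr rfl fun i _ => ?_
        rw [Finset.sum_comm]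
        refine Finset.sum_congr rfl fun k _ => ?_
        rw [Finset.sum_comm]
    _ = ∑ k, ∑ l, ∑ i, ∑ j,
        g k * g l * (if k ≤ i then (if l ≤ j then N i j else 0) else 0) := by
        rw [Finset.sum_comm]
        refine Finset.sum_congr rfl fun k _ => ?_
        rw [Finset.sum_comm]
    _ = _ := by
        refine Finset.sum_congr rfl fun k _ => Finset.sum_congr rfl fun l _ => ?_
        rw [Finset.mul_sum]
        refine Finset.sum_congr rfl fun i _ => ?_
        split_ifs
        · rw [Finset.mul_sum]
        · simp

/-- The quadratic form `2 ∑ gₖ² + 2 ∑ gₖ gₖ₊₁` as a double sum over a tridiagonal matrix. -/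
theorem sum_tridiagonal (g : ℕ → ℝ) (n : ℕ) :
    ∑ k ∈ range (n + 1), ∑ l ∈ range (n + 1),
      g k * g l * (if k = l then 2 else if k + 1 = l ∨ l + 1 = k then 1 else 0) =
    g 0 ^ 2 + ∑ k ∈ range n, (g k + g (k + 1)) ^ 2 + g n ^ 2 := by
  induction n with
  | zero => simp; ring
  | succ n ih =>
    have hrow : ∑ l ∈ range (n + 1), g (n + 1) * g l *
        (if n + 1 = l then 2 else if n + 1 + 1 = l ∨ l + 1 = n + 1 then 1 else 0) =
        g (n + 1) * g n := by
      rw [Finset.sum_eq_single n]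
      · simp
      · intro l hl hne
        have := Finset.mem_range.1 hl
        rw [if_neg (by omega), if_neg (by omega), mul_zero]
      · simp
    have hcol : ∑ k ∈ range (n + 1), g k * g (n + 1) *
        (if k = n + 1 then 2 else if k + 1 = n + 1 ∨ n + 1 + 1 = k then 1 else 0) =
        g n * g (n + 1) := by
      rw [Finset.sum_eq_single n]
      · simp
      · intro l hl hne
        have := Finset.mem_range.1 hl
        rw [if_neg (by omega), if_neg (by omega), mul_zero]
      · simp
    rw [Finset.sum_range_succ]
    simp_rw [Finset.sum_range_succ _ (n + 1)]
    rw [Finset.sum_add_distrib, ih, hrow, hcol, Finset.sum_range_succ _ n]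
    simp
    ring

/-- The difference of the two sides is a square, vanishing when a : b = u : v. Taking sine weights
therefore makes the Wirtinger bound below lossless along an eigenvector. -/
theorem sq_sub_ge_of_weights {a b u v : ℝ} (hu : 0 < u) (hv : 0 < v) :
    a ^ 2 * (1 - v / u) + b ^ 2 * (1 - u / v) ≤ (a - b) ^ 2 := by
  have : (a - b) ^ 2 - (a ^ 2 * (1 - v / u) + b ^ 2 * (1 - u / v)) =
      (a * v - b * u) ^ 2 / (u * v) := by
    field_simp; ring
  have h2 : 0 ≤ (a * v - b * u) ^ 2 / (u * v) := by positivity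
  linarith

/-- Discrete Wirtinger inequality for two interleaved chains that are pinned at zero. -/
theorem interleaved_wirtinger_aux {θ : ℝ} (y : ℕ → ℝ) (hy : y 0 = 0) (n : ℕ)
    (hpos : ∀ k : ℕ, 1 ≤ k → k ≤ n + 1 → 0 < Real.sin (((k + 1) / 2 : ℕ) * θ)) :
    (2 - 2 * Real.cos θ) * ∑ k ∈ range (n + 1), y (k + 1) ^ 2 +
      (Real.sin (((n + 4) / 2 : ℕ) * θ) / Real.sin (((n + 2) / 2 : ℕ) * θ) - 1) * y (n + 1) ^ 2 +
      (Real.sin (((n + 3) / 2 : ℕ) * θ) / Real.sin (((n + 1) / 2 : ℕ) * θ) - 1) * y n ^ 2 ≤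
    y 1 ^ 2 + ∑ k ∈ range n, (y (k + 2) - y k) ^ 2 := by
  have hrec : ∀ m : ℕ, Real.sin ((m + 2 : ℕ) * θ) =
      2 * Real.cos θ * Real.sin ((m + 1 : ℕ) * θ) - Real.sin (m * θ) := by
    intro m
    have e1 : ((m + 2 : ℕ) : ℝ) * θ = (m + 1 : ℕ) * θ + θ := by push_cast; ring
    have e2 : (m : ℝ) * θ = (m + 1 : ℕ) * θ - θ := by push_cast; ring
    rw [e1, e2, Real.sin_add, Real.sin_sub]; ring
  -- The two boundary terms correct the coefficients at the current chain ends, which have met only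
  -- one edge. The next edge completes the coefficient of `y n` to 2 - 2cos θ, by `hrec`.
  induction n with
  | zero =>
    have h1 := hpos 1 le_rfl (by norm_num)
    have h2 := hrec 0
    norm_num at h1 h2
    simp [hy]
    rw [h2, mul_div_assoc, div_self h1.ne']
    nlinarith
  | succ n ih =>
    have ih' := ih fun k h1 h2 => hpos k h1 (by omega)
    rw [Finset.sum_range_succ (fun k => y (k + 1) ^ 2) (n + 1),
      Finset.sum_range_succ (fun k => (y (k + 2) - y k) ^ 2) n]
    have hu := hpos (n + 2) (by omega) (by omega)
    rw [show (n + 2 + 1) / 2 = (n + 1) / 2 + 1 by omega] at hu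
    have hr := hrec ((n + 1) / 2)
    rw [show (n + 1 + 4) / 2 = (n + 1) / 2 + 2 by omega,
      show (n + 1 + 2) / 2 = (n + 1) / 2 + 1 by omega,
      show (n + 1 + 3) / 2 = (n + 4) / 2 by omega,
      show (n + 1 + 1) / 2 = (n + 2) / 2 by omega]
    rw [show (n + 3) / 2 = (n + 1) / 2 + 1 by omega] at ih'
    set u := Real.sin (((n + 1) / 2 + 1 : ℕ) * θ)
    set v := Real.sin (((n + 1) / 2 : ℕ) * θ) with hv
    have hw : Real.sin (((n + 1) / 2 + 2 : ℕ) * θ) / u = 2 * Real.cos θ - v / u := by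
      rw [hr]; field_simp
    rw [hw]
    -- For n = 0 the edge starts at the pinned vertex, where v = 0 and the weighted inequality is
    -- unavailable.
    have key : y (n + 2) ^ 2 * (1 - v / u) + y n ^ 2 * (1 - u / v) ≤ (y (n + 2) - y n) ^ 2 := by
      rcases Nat.eq_zero_or_pos n with rfl | hn
      · simp [hy, hv]
      · exact sq_sub_ge_of_weights hu (hpos n hn (by omega))
    rw [show n + 1 + 1 = n + 2 by rfl]
    nlinarith

/-- The leftover end terms are nonnegative when sin((m+1)θ) ≥ sin(mθ), which follows from (2m+1)θ ≤
π. The longer chain has m = ⌊(n+2)/2⌋ vertices, so 2m+1 ≤ n+3 and θ = π/(n+3) suffices. -/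
theorem interleaved_wirtinger (y : ℕ → ℝ) (hy : y 0 = 0) (n : ℕ) :
    (2 - 2 * Real.cos (Real.pi / (n + 3))) * ∑ k ∈ range (n + 1), y (k + 1) ^ 2 ≤
    y 1 ^ 2 + ∑ k ∈ range n, (y (k + 2) - y k) ^ 2 := by
  set θ := Real.pi / (n + 3) with hθ
  have hθ0 : 0 < θ := by positivity
  have hθn : (n + 3) * θ = Real.pi := by rw [hθ]; field_simp
  have hpos : ∀ m : ℕ, 1 ≤ m → m ≤ n + 2 → 0 < Real.sin (m * θ) := by
    intro m h1 h2
    have h1' : (1 : ℝ) ≤ m := by exact_mod_cast h1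
    have h2' : (m : ℝ) ≤ n + 2 := by exact_mod_cast h2
    apply Real.sin_pos_of_pos_of_lt_pi <;> nlinarith
  have hmono : ∀ m : ℕ, 1 ≤ m → 2 * m + 1 ≤ n + 3 →
      0 ≤ Real.sin ((m + 1 : ℕ) * θ) / Real.sin (m * θ) - 1 := by
    intro m h1 h2
    rw [sub_nonneg, one_le_div (hpos m h1 (by omega)), ← sub_nonneg, Real.sin_sub_sin]
    have h2' : (2 * m + 1 : ℝ) ≤ n + 3 := by exact_mod_cast h2
    have hs : 0 ≤ Real.sin (((m + 1 : ℕ) * θ - m * θ) / 2) := by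
      apply Real.sin_nonneg_of_nonneg_of_le_pi <;> push_cast <;> nlinarith
    have hc : 0 ≤ Real.cos (((m + 1 : ℕ) * θ + m * θ) / 2) := by
      apply Real.cos_nonneg_of_neg_pi_div_two_le_of_le <;> push_cast <;> nlinarith [Real.pi_pos]
    positivity
  have h := interleaved_wirtinger_aux (θ := θ) y hy n fun k h1 h2 => hpos _ (by omega) (by omega)
  have a1 := hmono ((n + 2) / 2) (by omega) (by omega)
  rw [show (n + 2) / 2 + 1 = (n + 4) / 2 by omega] at a1
  have a2 : 0 ≤ (Real.sin (((n + 3) / 2 : ℕ) * θ) / Real.sin (((n + 1) / 2 : ℕ) * θ) - 1)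
      * y n ^ 2 := by
    rcases Nat.eq_zero_or_pos n with rfl | hn
    · simp [hy]
    · have := hmono ((n + 1) / 2) (by omega) (by omega)
      rw [show (n + 1) / 2 + 1 = (n + 3) / 2 by omega] at this
      positivity
  nlinarith [mul_nonneg a1 (sq_nonneg (y (n + 1)))]

/-- If all tail sums of `N` dominate those of the tridiagonal form, then the quadratic form of `N`
on nonnegative monotone vectors is bounded below. -/
theorem quadratic_form_ge_of_tail_sums {n : ℕ} (N : Fin (n + 1) → Fin (n + 1) → ℝ)
    (hN : ∀ k l : Fin (n + 1),
      (if (k : ℕ) = l then 2 else if (k : ℕ) + 1 = l ∨ (l : ℕ) + 1 = k then 1 else 0) ≤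
        ∑ i ∈ Ici k, ∑ j ∈ Ici l, N i j)
    (x : Fin (n + 1) → ℝ) (hx : Monotone x) (hx0 : ∀ i, 0 ≤ x i) :
    (2 - 2 * Real.cos (Real.pi / (n + 3))) * ∑ i, x i ^ 2 ≤ ∑ i, ∑ j, N i j * (x i * x j) := by
  -- The prepended 0 pins the even chain and makes `g 0` the least entry of x.
  let y : ℕ → ℝ := fun k => if k = 0 then 0 else if h : k - 1 < n + 1 then x ⟨k - 1, h⟩ else 0
  have hy0 : y 0 = 0 := rfl
  have hyx : ∀ i : Fin (n + 1), y (i + 1) = x i := by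
    intro i
    simp only [y, Nat.add_sub_cancel]
    rw [if_neg (by omega), dif_pos i.2]
  let g : ℕ → ℝ := fun k => y (k + 1) - y k
  have hg : ∀ k : Fin (n + 1), 0 ≤ g k := by
    rintro ⟨k, hk⟩
    rcases k with _ | k
    · simpa [g, y] using hx0 0
    · have := hyx ⟨k + 1, hk⟩
      have h2 := hyx ⟨k, by omega⟩
      simp only [g] at *
      rw [this, h2, sub_nonneg]
      exact hx (by simp [Fin.le_def])
  have hxg : ∀ i : Fin (n + 1), x i = ∑ k : Fin (n + 1), if k ≤ i then g k else 0 := by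
    intro i
    have h1 : ∑ k : Fin (n + 1), (if k ≤ i then g k else 0) =
        ∑ k ∈ range (n + 1), if k ≤ (i : ℕ) then g k else 0 := by
      rw [Finset.sum_range]; rfl
    rw [h1, ← Finset.sum_filter]
    have h2 : (range (n + 1)).filter (fun k => k ≤ (i : ℕ)) = range (i + 1) := by
      ext k; simp; omega
    rw [h2, Finset.sum_range_sub, hy0, hyx, sub_zero]
  rw [sum_mul_mul_eq_sum_tail N (fun k => g k) x hxg]
  calc _ = (2 - 2 * Real.cos (Real.pi / (n + 3))) * ∑ k ∈ range (n + 1), y (k + 1) ^ 2 := by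
        rw [Finset.sum_range]; simp_rw [hyx]
    _ ≤ y 1 ^ 2 + ∑ k ∈ range n, (y (k + 2) - y k) ^ 2 := interleaved_wirtinger y hy0 n
    _ ≤ g 0 ^ 2 + ∑ k ∈ range n, (g k + g (k + 1)) ^ 2 + g n ^ 2 := by
        have : ∀ k, g k + g (k + 1) = y (k + 2) - y k := by intro k; simp only [g]; ring
        simp_rw [this]
        simp only [g, hy0, sub_zero, zero_add]
        -- Since `g 0 ^ 2` is `y 1 ^ 2`, only `g n ^ 2` is discarded.
        nlinarith [sq_nonneg (y (n + 1) - y n)]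
    _ = ∑ k : Fin (n + 1), ∑ l : Fin (n + 1), g k * g l *
        (if (k : ℕ) = l then 2 else if (k : ℕ) + 1 = l ∨ (l : ℕ) + 1 = k then 1 else 0) := by
        rw [← sum_tridiagonal, Finset.sum_range]
        refine Finset.sum_congr rfl fun k _ => ?_
        rw [Finset.sum_range]
    _ ≤ _ := Finset.sum_le_sum fun k _ => Finset.sum_le_sum fun l _ =>
        mul_le_mul_of_nonneg_left (hN k l) (mul_nonneg (hg k) (hg l))

/-! ### Integer bounds for the form of 3I - A on vertex sets -/

theorem filter_adj_card_le {V : Type*} [Fintype V] (G : SimpleGraph V) [DecidableRel G.Adj]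
    (hdeg : ∀ v, G.degree v ≤ 3) (T : Finset V) (i : V) :
    (T.filter (G.Adj i)).card ≤ 3 := by
  refine (Finset.card_le_card ?_).trans (hdeg i)
  intro j; simp

section CutForm

variable {V : Type*} [DecidableEq V] (G : SimpleGraph V) [DecidableRel G.Adj]

/-- The entries of the matrix `3 I - A`, where `A` is the adjacency matrix of `G`. -/
def cubicDefect (i j : V) : ℤ := (if i = j then 3 else 0) - (if G.Adj i j then 1 else 0)

/-- The bilinear form of `3 I - A` on indicator vectors. -/
def cutForm (S T : Finset V) : ℤ := ∑ i ∈ S, ∑ j ∈ T, cubicDefect G i j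

theorem cubicDefect_comm (i j : V) : cubicDefect G i j = cubicDefect G j i := by
  simp [cubicDefect, G.adj_comm, eq_comm]

theorem cutForm_comm (S T : Finset V) : cutForm G S T = cutForm G T S := by
  unfold cutForm
  rw [Finset.sum_comm]
  simp_rw [cubicDefect_comm G]

theorem sum_cubicDefect {T : Finset V} {i : V} (hi : i ∈ T) :
    ∑ j ∈ T, cubicDefect G i j = 3 - (T.filter (G.Adj i)).card := by
  simp [cubicDefect, Finset.sum_sub_distrib, hi]

/-- Write Q for the form and S' = S ∪ {w}. Since Q(w, w) = 3, 2Q(S', S) = Q(S', S') + Q(S, S) - 3 ≥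
1, and Q is an integer. -/
theorem one_le_cutForm_insert (hcut : ∀ S : Finset V, S.Nonempty → 2 ≤ cutForm G S S)
    {S : Finset V} (hS : S.Nonempty) {w : V} (hw : w ∉ S) : 1 ≤ cutForm G (insert w S) S := by
  have h1 := hcut S hS
  have h2 := hcut (insert w S) ⟨w, by simp⟩
  have e : ∀ T, cutForm G (insert w S) T = cutForm G {w} T + cutForm G S T := by
    intro T
    simp [cutForm, Finset.sum_insert hw]
  have h3 : cutForm G {w} {w} = 3 := by simp [cutForm, cubicDefect]
  rw [e, cutForm_comm G {w}, cutForm_comm G S (insert w S), e, e, h3, cutForm_comm G S {w}] at h2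
  rw [e]
  omega

variable [Fintype V]

/-- Nestedness puts the diagonal entry 3 in every row, where it outweighs the at most three
neighbours. -/
theorem cutForm_nonneg (hdeg : ∀ v, G.degree v ≤ 3) {S T : Finset V} (h : S ⊆ T) :
    0 ≤ cutForm G S T := by
  refine Finset.sum_nonneg fun i hi => ?_
  rw [sum_cubicDefect G (h hi)]
  have := filter_adj_card_le G hdeg T i
  omega

/-- If the value were 0, every vertex of S would have degree 3 with all neighbours in S; by
connectedness S would be everything and G cubic. -/
theorem cutForm_self_pos (hdeg : ∀ v, G.degree v ≤ 3) (hconn : G.Connected)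
    (hreg : ¬ G.IsRegularOfDegree 3) {S : Finset V} (hS : S.Nonempty) : 0 < cutForm G S S := by
  refine lt_of_le_of_ne (cutForm_nonneg G hdeg (Finset.Subset.refl S)) fun h0 => hreg ?_
  have hrow : ∀ i ∈ S, ∑ j ∈ S, cubicDefect G i j = 0 := by
    refine (Finset.sum_eq_zero_iff_of_nonneg fun i hi => ?_).1 h0.symm
    rw [sum_cubicDefect G hi]
    have := filter_adj_card_le G hdeg S i
    omega
  have hcard : ∀ i ∈ S, S.filter (G.Adj i) = G.neighborFinset i ∧ G.degree i = 3 := by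
    intro i hi
    have h := hrow i hi
    rw [sum_cubicDefect G hi] at h
    have hsub : S.filter (G.Adj i) ⊆ G.neighborFinset i := by intro j; simp
    have h3 := hdeg i
    have hle := Finset.card_le_card hsub
    rw [G.card_neighborFinset_eq_degree] at hle
    refine ⟨Finset.eq_of_subset_of_card_le hsub ?_, by omega⟩
    rw [G.card_neighborFinset_eq_degree]
    omega
  have hclosed : ∀ i j, G.Adj i j → i ∈ S → j ∈ S := by
    intro i j hij hi
    have : j ∈ G.neighborFinset i := by simpa using hij
    rw [← (hcard i hi).1] at this
    exact (Finset.mem_filter.1 this).1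
  obtain ⟨s, hs⟩ := hS
  intro v
  obtain ⟨w⟩ := hconn.preconnected s v
  have hall : ∀ {a b : V}, G.Walk a b → a ∈ S → b ∈ S := by
    intro a b w
    induction w with
    | nil => exact id
    | cons h _ ih => exact fun ha => ih (hclosed _ _ h ha)
  exact (hcard v (hall w hs)).2

/-- Let U, W be the colour classes of S and e the number of edges between them. The value is (3|U| -
e) + (3|W| - e), two nonnegative integers congruent modulo 3, so their sum cannot be 1. -/
theorem two_le_cutForm_self (hdeg : ∀ v, G.degree v ≤ 3) (hconn : G.Connected)
    (hreg : ¬ G.IsRegularOfDegree 3) (hbip : G.IsBipartite) {S : Finset V} (hS : S.Nonempty) :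
    2 ≤ cutForm G S S := by
  have hpos := cutForm_self_pos G hdeg hconn hreg hS
  obtain ⟨c⟩ := hbip
  let U := S.filter fun i => c i = 0
  let W := S.filter fun i => ¬ c i = 0
  have hsame : ∀ i j, (c i = 0 ↔ c j = 0) → ¬ G.Adj i j := by
    intro i j h hij
    have := c.valid hij
    omega
  have hsplit : cutForm G S S = cutForm G U U + cutForm G U W + cutForm G W U + cutForm G W W := by
    unfold cutForm
    rw [← Finset.sum_filter_add_sum_filter_not S (fun i => c i = 0)]
    simp_rw [← Finset.sum_filter_add_sum_filter_not S (fun i => c i = 0) (cubicDefect G _)]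
    rw [Finset.sum_add_distrib, Finset.sum_add_distrib]
    ring
  have hdiag : ∀ T : Finset V, (∀ i ∈ T, ∀ j ∈ T, ¬ G.Adj i j) → cutForm G T T = 3 * T.card := by
    intro T hT
    unfold cutForm
    rw [Finset.sum_congr rfl (g := fun _ => (3 : ℤ))]
    · simp [mul_comm]
    · intro i hi
      rw [sum_cubicDefect G hi, Finset.filter_false_of_mem (hT i hi)]
      simp
  have hU : cutForm G U U = 3 * U.card := hdiag U fun i hi j hj => hsame i j (by simp_all [U])
  have hW : cutForm G W W = 3 * W.card := hdiag W fun i hi j hj => hsame i j (by simp_all [W])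
  have hUS : 0 ≤ cutForm G U S := cutForm_nonneg G hdeg (Finset.filter_subset _ _)
  have hWS : 0 ≤ cutForm G W S := cutForm_nonneg G hdeg (Finset.filter_subset _ _)
  have hsp : ∀ T, cutForm G T S = cutForm G T U + cutForm G T W := by
    intro T
    unfold cutForm
    simp_rw [← Finset.sum_filter_add_sum_filter_not S (fun i => c i = 0) (cubicDefect G _)]
    rw [Finset.sum_add_distrib]
  rw [hsp] at hUS hWS
  rw [cutForm_comm G W U] at hsplit hWS
  omega

end CutForm

/-- The key inequality: the form of `3 I - A` on nonnegative vectors. -/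
theorem cubicDefect_quadratic_form_ge {n : ℕ} (G : SimpleGraph (Fin (n + 1))) [DecidableRel G.Adj]
    (hdeg : ∀ v, G.degree v ≤ 3) (hconn : G.Connected)
    (hreg : ¬ G.IsRegularOfDegree 3) (hbip : G.IsBipartite)
    (x : Fin (n + 1) → ℝ) (hx0 : ∀ i, 0 ≤ x i) :
    (2 - 2 * Real.cos (Real.pi / (n + 3))) * ∑ i, x i ^ 2 ≤
      ∑ i, ∑ j, (cubicDefect G i j : ℝ) * (x i * x j) := by
  let σ := Tuple.sort x
  have hcut : ∀ S : Finset (Fin (n + 1)), S.Nonempty → 2 ≤ cutForm G S S :=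
    fun S hS => two_le_cutForm_self G hdeg hconn hreg hbip hS
  let T : Fin (n + 1) → Finset (Fin (n + 1)) := fun k => (Ici k).map σ.toEmbedding
  have hT : ∀ k, (T k).Nonempty := fun k => ⟨σ k, by simp [T]⟩
  have hsub : ∀ k l, k ≤ l → T l ⊆ T k := fun k l h =>
    Finset.map_subset_map.2 (Finset.Ici_subset_Ici.2 h)
  have hsucc : ∀ k l : Fin (n + 1), (k : ℕ) + 1 = l → 1 ≤ cutForm G (T k) (T l) := by
    intro k l h
    have hins : T k = insert (σ k) (T l) := by
      have : Ici k = insert k (Ici l) := by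
        ext i; simp only [Finset.mem_Ici, Finset.mem_insert, Fin.le_def, Fin.ext_iff]; omega
      simp only [T, this, Finset.map_insert]
      rfl
    rw [hins]
    refine one_le_cutForm_insert G hcut (hT l) ?_
    simp only [T, Finset.mem_map_equiv, Equiv.symm_apply_apply, Finset.mem_Ici, Fin.le_def]
    omega
  have htail : ∀ k l, ∑ i ∈ Ici k, ∑ j ∈ Ici l, (cubicDefect G (σ i) (σ j) : ℝ) =
      (cutForm G (T k) (T l) : ℤ) := by
    intro k l
    simp [cutForm, T]
  have h := quadratic_form_ge_of_tail_sums (fun i j => (cubicDefect G (σ i) (σ j) : ℝ)) ?_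
    (x ∘ σ) (Tuple.monotone_sort x) (fun i => hx0 _)
  · have e1 : ∑ i, (x ∘ σ) i ^ 2 = ∑ i, x i ^ 2 := Equiv.sum_comp σ fun i => x i ^ 2
    have e2 : ∑ i, ∑ j, (cubicDefect G (σ i) (σ j) : ℝ) * ((x ∘ σ) i * (x ∘ σ) j) =
        ∑ i, ∑ j, (cubicDefect G i j : ℝ) * (x i * x j) := by
      rw [← Equiv.sum_comp σ fun i => ∑ j, (cubicDefect G i j : ℝ) * (x i * x j)]
      refine Finset.sum_congr rfl fun i _ => ?_
      exact Equiv.sum_comp σ fun j => (cubicDefect G (σ i) j : ℝ) * (x (σ i) * x j)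
    rwa [e1, e2] at h
  · intro k l
    rw [htail]
    split_ifs with h1 h2
    · rw [Fin.ext h1]
      exact_mod_cast hcut _ (hT l)
    · rcases h2 with h2 | h2
      · exact_mod_cast hsucc k l h2
      · rw [cutForm_comm]
        exact_mod_cast hsucc l k h2
    · rcases le_total k l with h | h
      · rw [cutForm_comm]
        exact_mod_cast cutForm_nonneg G hdeg (hsub k l h)
      · exact_mod_cast cutForm_nonneg G hdeg (hsub l k h)

/-! ### Spectral radius through quadratic forms and test vectors -/

/-- Both sides say that cI - A is positive semidefinite. A nonempty vertex set is needed for the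
supremum to be over a nonempty spectrum. -/
theorem graphSpectralRadius_le_iff {n : ℕ} [NeZero n] (G : SimpleGraph (Fin n))
    [DecidableRel G.Adj] (c : ℝ) :
    graphSpectralRadius G ≤ c ↔
      ∀ x : Fin n → ℝ, ∑ i, ∑ j, (if G.Adj i j then x i * x j else 0) ≤ c * ∑ i, x i ^ 2 := by
  have hr : graphSpectralRadius G = sSup (spectrum ℝ (G.adjMatrix ℝ)) := by
    unfold graphSpectralRadius
    congr!
  have hA : (G.adjMatrix ℝ).IsHermitian := by
    rw [Matrix.IsHermitian, Matrix.conjTranspose_eq_transpose_of_trivial, G.transpose_adjMatrix]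
  have hM : (algebraMap ℝ (Matrix (Fin n) (Fin n) ℝ) c - G.adjMatrix ℝ).IsHermitian := by
    refine Matrix.IsHermitian.sub ?_ hA
    rw [Algebra.algebraMap_eq_smul_one, Matrix.IsHermitian, Matrix.conjTranspose_smul]
    simp
  have hspec : graphSpectralRadius G ≤ c ↔
      spectrum ℝ (algebraMap ℝ (Matrix (Fin n) (Fin n) ℝ) c - G.adjMatrix ℝ) ⊆ {a | 0 ≤ a} := by
    rw [hr, ← spectrum.singleton_sub_eq, hA.spectrum_real_eq_range_eigenvalues,
      csSup_le_iff (Set.finite_range _).bddAbove (Set.range_nonempty _)]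
    simp [Set.subset_def]
  have hpsd : (algebraMap ℝ (Matrix (Fin n) (Fin n) ℝ) c - G.adjMatrix ℝ).PosSemidef ↔
      spectrum ℝ (algebraMap ℝ (Matrix (Fin n) (Fin n) ℝ) c - G.adjMatrix ℝ) ⊆ {a | 0 ≤ a} := by
    rw [Matrix.posSemidef_iff_isHermitian_and_spectrum_nonneg, and_iff_right hM]
  rw [hspec, ← hpsd, Matrix.posSemidef_iff_dotProduct_mulVec, and_iff_right hM]
  refine forall_congr' fun x => ?_
  have e : star x ⬝ᵥ ((algebraMap ℝ (Matrix (Fin n) (Fin n) ℝ) c - G.adjMatrix ℝ).mulVec x) =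
      c * ∑ i, x i ^ 2 - ∑ i, ∑ j, (if G.Adj i j then x i * x j else 0) := by
    rw [Matrix.sub_mulVec, dotProduct_sub, Algebra.algebraMap_eq_smul_one, Matrix.smul_mulVec,
      Matrix.one_mulVec, dotProduct_smul]
    congr 1
    · simp [dotProduct, pow_two]
    · simp only [dotProduct, Matrix.mulVec, Finset.mul_sum, SimpleGraph.adjMatrix_apply,
        star_trivial]
      refine Finset.sum_congr rfl fun i _ => Finset.sum_congr rfl fun j _ => ?_
      split_ifs <;> ring
  rw [e, sub_nonneg]

/-- Multiplying the pointwise inequalities by x i ≥ 0 and summing gives a Rayleigh quotient bound.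
-/
theorem le_graphSpectralRadius {n : ℕ} [NeZero n] (G : SimpleGraph (Fin n))
    [DecidableRel G.Adj] {c : ℝ} {x : Fin n → ℝ} (hx0 : ∀ i, 0 ≤ x i) {i₀ : Fin n}
    (hi₀ : 0 < x i₀) (h : ∀ i, c * x i ≤ ∑ j, if G.Adj i j then x j else 0) :
    c ≤ graphSpectralRadius G := by
  have h1 := (graphSpectralRadius_le_iff G _).1 le_rfl x
  have hpos : 0 < ∑ i, x i ^ 2 :=
    Finset.sum_pos' (fun i _ => sq_nonneg _) ⟨i₀, Finset.mem_univ _, by positivity⟩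
  have h2 : c * ∑ i, x i ^ 2 ≤ ∑ i, ∑ j, (if G.Adj i j then x i * x j else 0) := by
    rw [Finset.mul_sum]
    refine Finset.sum_le_sum fun i _ => ?_
    have := mul_le_mul_of_nonneg_left (h i) (hx0 i)
    rw [Finset.mul_sum] at this
    simp_rw [mul_ite, mul_zero] at this
    linarith
  exact le_of_mul_le_mul_right (h2.trans h1) hpos

theorem graphSpectralRadius_le_of_mem {n : ℕ} {G : SimpleGraph (Fin (n + 1))}
    (hG : G ∈ irregularBipartiteGraphs (n + 1) 3) :
    graphSpectralRadius G ≤ 3 - (2 - 2 * Real.cos (Real.pi / (n + 3))) := by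
  classical
  obtain ⟨⟨hconn, hreg, hmax⟩, hbip⟩ := hG
  have hdeg : ∀ v, G.degree v ≤ 3 := fun v => by
    have := G.degree_le_maxDegree v
    convert this
    convert hmax.symm
  have hreg3 : ¬ G.IsRegularOfDegree 3 := fun h => hreg ⟨3, by convert h⟩
  rw [graphSpectralRadius_le_iff]
  intro x
  have h := cubicDefect_quadratic_form_ge G hdeg hconn hreg3 hbip (fun i => |x i|)
    (fun i => abs_nonneg _)
  have e : ∑ i, ∑ j, (cubicDefect G i j : ℝ) * (|x i| * |x j|) =
      3 * ∑ i, x i ^ 2 - ∑ i, ∑ j, (if G.Adj i j then |x i| * |x j| else 0) := by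
    rw [Finset.mul_sum, ← Finset.sum_sub_distrib]
    refine Finset.sum_congr rfl fun i _ => ?_
    simp [cubicDefect, sub_mul, Finset.sum_sub_distrib, ← pow_two]
  rw [e] at h
  simp_rw [sq_abs] at h
  have hle : ∑ i, ∑ j, (if G.Adj i j then x i * x j else 0) ≤
      ∑ i, ∑ j, (if G.Adj i j then |x i| * |x j| else 0) := by
    refine Finset.sum_le_sum fun i _ => Finset.sum_le_sum fun j _ => ?_
    split_ifs
    · rw [← abs_mul]; exact le_abs_self _
    · rfl
  linarith

theorem mem_irregularBipartiteGraphs {n : ℕ} {G : SimpleGraph (Fin n)} [DecidableRel G.Adj]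
    {d : ℕ} (hconn : G.Connected) (hbip : G.IsBipartite) (hle : ∀ v, G.degree v ≤ d)
    {a b : Fin n} (ha : G.degree a = d) (hb : G.degree b ≠ d) :
    G ∈ irregularBipartiteGraphs n d := by
  refine ⟨⟨hconn, ?_, ?_⟩, hbip⟩
  · rintro ⟨e, he⟩
    refine hb (Eq.trans ?_ ha)
    have h1 := he a
    have h2 := he b
    rw [← h2] at h1
    convert h1.symm
  · refine Eq.trans (b := G.maxDegree) (by congr!) ?_
    refine le_antisymm ?_ (ha ▸ G.degree_le_maxDegree a)
    exact G.maxDegree_le_of_forall_degree_le _ hle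

/-! ### Extremal examples: the capped ladder and the claw -/

/-- The neighbours of the vertex `i` in the infinite cubic bipartite ladder with one end, which is
closed by a copy of `K₃,₃` minus an edge. -/
def ladderNeighbors (i : ℕ) : Finset ℕ :=
  if i < 4 then (if i % 2 = 0 then {1, 3, 5} else {0, 2, 4})
  else if i = 4 then {1, 3, 7}
  else if i = 5 then {0, 2, 6}
  else if i % 2 = 0 then {i - 1, i + 1, i + 3} else {i - 3, i - 1, i + 1}

theorem ladderNeighbors_mod_two {i j : ℕ} (h : j ∈ ladderNeighbors i) : i % 2 ≠ j % 2 := by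
  unfold ladderNeighbors at h
  split_ifs at h <;> simp at h <;> omega

theorem ladderNeighbors_symm {i j : ℕ} (h : j ∈ ladderNeighbors i) : i ∈ ladderNeighbors j := by
  unfold ladderNeighbors at h ⊢
  split_ifs at h <;> simp at h <;> split_ifs <;> simp <;> omega

theorem ladderNeighbors_card_le (i : ℕ) : (ladderNeighbors i).card ≤ 3 := by
  unfold ladderNeighbors
  split_ifs <;> exact Finset.card_le_three

/-- The first `n` vertices of the capped ladder. -/
def cappedLadder (n : ℕ) : SimpleGraph (Fin n) where
  Adj i j := (j : ℕ) ∈ ladderNeighbors i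
  symm := ⟨fun _ _ h => ladderNeighbors_symm h⟩
  loopless := ⟨fun _ h => ladderNeighbors_mod_two h rfl⟩

instance cappedLadderDecidableAdj (n : ℕ) : DecidableRel (cappedLadder n).Adj :=
  fun i j => inferInstanceAs (Decidable ((j : ℕ) ∈ ladderNeighbors i))

theorem cappedLadder_isBipartite (n : ℕ) : (cappedLadder n).IsBipartite :=
  ⟨SimpleGraph.Coloring.mk (fun i => (⟨(i : ℕ) % 2, Nat.mod_lt _ two_pos⟩ : Fin 2))
    fun h he => ladderNeighbors_mod_two h (by simpa using he)⟩

theorem cappedLadder_degree (n : ℕ) (i : Fin n) :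
    (cappedLadder n).degree i = ((ladderNeighbors i).filter (· < n)).card := by
  rw [← SimpleGraph.card_neighborFinset_eq_degree, ← Finset.card_map Fin.valEmbedding]
  congr 1
  ext j
  simp only [Finset.mem_map, SimpleGraph.mem_neighborFinset, Fin.valEmbedding_apply,
    Finset.mem_filter]
  constructor
  · rintro ⟨k, hk, rfl⟩
    exact ⟨hk, k.2⟩
  · rintro ⟨h1, h2⟩
    exact ⟨⟨j, h2⟩, h1, rfl⟩

theorem exists_smaller_ladderNeighbor {i : ℕ} (hi : 0 < i) : ∃ j < i, j ∈ ladderNeighbors i := by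
  -- The edge between 4 and 5 is the one removed from K₃,₃.
  by_cases h5 : i = 5
  · exact ⟨0, by omega, by simp [h5, ladderNeighbors]⟩
  · refine ⟨i - 1, by omega, ?_⟩
    unfold ladderNeighbors
    split_ifs <;> simp <;> omega

theorem exists_larger_ladderNeighbor {i : ℕ} (hi : 4 ≤ i) : ∃ j, i < j ∧ j ∈ ladderNeighbors i := by
  by_cases h : i % 2 = 0
  · refine ⟨i + 3, by omega, ?_⟩
    unfold ladderNeighbors
    split_ifs <;> simp <;> omega
  · refine ⟨i + 1, by omega, ?_⟩
    unfold ladderNeighbors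
    split_ifs <;> simp <;> omega

theorem cappedLadder_connected {n : ℕ} (hn : 0 < n) : (cappedLadder n).Connected := by
  have h : ∀ (k : ℕ) (hk : k < n), (cappedLadder n).Reachable ⟨0, hn⟩ ⟨k, hk⟩ := by
    intro k
    induction k using Nat.strong_induction_on with
    | _ k ih =>
      intro hk
      rcases Nat.eq_zero_or_pos k with rfl | hpos
      · rfl
      · obtain ⟨j, hj, hjk⟩ := exists_smaller_ladderNeighbor hpos
        refine (ih j hj (by omega)).trans (SimpleGraph.Adj.reachable ?_)
        exact ladderNeighbors_symm hjk
  have : Nonempty (Fin n) := ⟨⟨0, hn⟩⟩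
  exact ⟨fun u v => (h u u.2).symm.trans (h v v.2)⟩

theorem cappedLadder_mem {n : ℕ} (hn : 5 ≤ n) :
    cappedLadder n ∈ irregularBipartiteGraphs n 3 := by
  refine mem_irregularBipartiteGraphs (a := ⟨1, by omega⟩) (b := ⟨n - 1, by omega⟩)
    (cappedLadder_connected (by omega)) (cappedLadder_isBipartite n) (fun v => ?_) ?_ ?_
  · rw [cappedLadder_degree]
    exact (Finset.card_filter_le _ _).trans (ladderNeighbors_card_le _)
  · rw [cappedLadder_degree, Finset.filter_true_of_mem]
    · simp [ladderNeighbors]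
    · simp [ladderNeighbors]; omega
  · rw [cappedLadder_degree]
    -- Truncation cuts off a neighbour of the last vertex, so its degree drops below 3.
    obtain ⟨j, hj, hjm⟩ := exists_larger_ladderNeighbor (i := n - 1) (by omega)
    refine ne_of_lt (lt_of_lt_of_le (Finset.card_lt_card ?_) (ladderNeighbors_card_le (n - 1)))
    exact Finset.filter_ssubset.2 ⟨j, hjm, by omega⟩

/-- The star with three leaves. -/
def claw : SimpleGraph (Fin 4) where
  Adj i j := i ≠ j ∧ (i = 0 ∨ j = 0)
  symm := ⟨fun _ _ h => ⟨h.1.symm, h.2.symm⟩⟩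
  loopless := ⟨fun _ h => h.1 rfl⟩

instance clawDecidableAdj : DecidableRel claw.Adj :=
  fun i j => inferInstanceAs (Decidable (i ≠ j ∧ (i = 0 ∨ j = 0)))

/-- Needed for n = 4, where the capped ladder is a 4-cycle and hence regular. -/
theorem claw_mem : claw ∈ irregularBipartiteGraphs 4 3 := by
  have hreach : ∀ j : Fin 4, claw.Reachable 0 j := by
    intro j
    by_cases hj : j = 0
    · rw [hj]
    · exact SimpleGraph.Adj.reachable ⟨Ne.symm hj, Or.inl rfl⟩
  have hdeg : ∀ v : Fin 4, claw.degree v = if v = 0 then 3 else 1 := by decide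
  refine mem_irregularBipartiteGraphs (a := 0) (b := 1)
    ⟨fun u v => (hreach u).symm.trans (hreach v)⟩
    ⟨SimpleGraph.Coloring.mk (fun i => if i = 0 then (0 : Fin 2) else 1) ?_⟩ ?_ ?_ ?_
  · rintro i j ⟨hne, rfl | rfl⟩
    · simp [hne.symm]
    · simp [hne]
  · intro v; rw [hdeg]; split_ifs <;> norm_num
  · rw [hdeg]; rfl
  · rw [hdeg]; norm_num

theorem irregularBipartiteGraphs_nonempty {n : ℕ} (hn : 4 ≤ n) :
    (irregularBipartiteGraphs n 3).Nonempty := by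
  rcases hn.eq_or_lt with rfl | hn
  · exact ⟨_, claw_mem⟩
  · exact ⟨_, cappedLadder_mem hn⟩

/-- The vector depends only on the layer i / 2 and is constant on the cap, layers 0 to 2. A vertex
in a layer t ≥ 3 has one neighbour in each of the layers t-1, t, t+1, so the sine recurrence gives
the factor 1 + 2cos θ; the profile vanishes from layer T on. -/
theorem ladder_test_vector {T : ℕ} (hT : 3 ≤ T) {θ : ℝ} (hθ : (2 * T - 3) * θ = Real.pi) (i : ℕ) :
    (1 + 2 * Real.cos θ) * Real.sin ((T - max (i / 2) 2 : ℕ) * θ) ≤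
      ∑ j ∈ ladderNeighbors i, Real.sin ((T - max (j / 2) 2 : ℕ) * θ) := by
  have hT' : (3 : ℝ) ≤ T := by exact_mod_cast hT
  have hθ0 : 0 < θ := by
    by_contra h
    nlinarith [Real.pi_pos]
  have hnn : ∀ k : ℕ, 0 ≤ Real.sin ((T - max k 2 : ℕ) * θ) := by
    intro k
    have h1 : ((T - max k 2 : ℕ) : ℝ) ≤ T - 2 := by
      rw [le_sub_iff_add_le]
      exact_mod_cast (by omega : T - max k 2 + 2 ≤ T)
    have h0 : (0 : ℝ) ≤ (T - max k 2 : ℕ) := by positivity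
    apply Real.sin_nonneg_of_nonneg_of_le_pi <;> nlinarith
  have hrec : ∀ m : ℕ, 2 * Real.cos θ * Real.sin ((m + 1 : ℕ) * θ) =
      Real.sin ((m + 2 : ℕ) * θ) + Real.sin (m * θ) := by
    intro m
    have e1 : ((m + 2 : ℕ) : ℝ) * θ = (m + 1 : ℕ) * θ + θ := by push_cast; ring
    have e2 : (m : ℝ) * θ = (m + 1 : ℕ) * θ - θ := by push_cast; ring
    rw [e1, e2, Real.sin_add, Real.sin_sub]; ring
  -- Free-end condition at the cap: (2T-3)θ = π makes sin((T-1)θ) = sin((T-2)θ).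
  have hend : 2 * Real.cos θ * Real.sin ((T - 2 : ℕ) * θ) =
      Real.sin ((T - 2 : ℕ) * θ) + Real.sin ((T - 3 : ℕ) * θ) := by
    obtain ⟨m, rfl⟩ := Nat.exists_eq_add_of_le' hT
    have h := hrec m
    rw [show m + 3 - 2 = m + 1 by omega, show m + 3 - 3 = m by omega, h, ← Real.sin_pi_sub]
    congr 2
    rw [← hθ]; push_cast; ring
  have hcos := Real.cos_le_one θ
  have h2 := hnn 2
  simp only [max_self] at h2
  rcases lt_or_ge i 6 with hi | hi
  · interval_cases i <;> simp [ladderNeighbors] <;> nlinarith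
  · rcases le_or_gt T (i / 2) with hTi | hTi
    · rw [show T - max (i / 2) 2 = 0 by omega]
      simpa using Finset.sum_nonneg fun j _ => hnn (j / 2)
    · obtain ⟨m, hm⟩ := Nat.exists_eq_add_of_lt hTi
      have hsum : ∑ j ∈ ladderNeighbors i, Real.sin ((T - max (j / 2) 2 : ℕ) * θ) =
          Real.sin ((m + 2 : ℕ) * θ) + Real.sin ((m + 1 : ℕ) * θ) + Real.sin (m * θ) := by
        unfold ladderNeighbors
        rw [if_neg (by omega), if_neg (by omega), if_neg (by omega)]
        split_ifs with hp
        · rw [Finset.sum_insert (by simp; omega), Finset.sum_insert (by simp),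
            Finset.sum_singleton, show T - max ((i - 1) / 2) 2 = m + 2 by omega,
            show T - max ((i + 1) / 2) 2 = m + 1 by omega,
            show T - max ((i + 3) / 2) 2 = m by omega, add_assoc]
        · rw [Finset.sum_insert (by simp; omega), Finset.sum_insert (by simp),
            Finset.sum_singleton, show T - max ((i - 3) / 2) 2 = m + 2 by omega,
            show T - max ((i - 1) / 2) 2 = m + 1 by omega,
            show T - max ((i + 1) / 2) 2 = m by omega, add_assoc]
      rw [hsum, show T - max (i / 2) 2 = m + 1 by omega, add_mul, hrec]
      linarith

theorem cappedLadder_radius_ge {n : ℕ} (hn : 6 ≤ n) :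
    3 - Real.pi ^ 2 / ((n : ℝ) - 4) ^ 2 ≤ graphSpectralRadius (cappedLadder n) := by
  have : NeZero n := ⟨by omega⟩
  obtain ⟨T, hT⟩ : ∃ T, T = n / 2 := ⟨_, rfl⟩
  have hT3 : 3 ≤ T := by omega
  have hT3' : (3 : ℝ) ≤ T := by exact_mod_cast hT3
  have hn' : (6 : ℝ) ≤ n := by exact_mod_cast hn
  -- This yields 2T - 3 ≥ n - 4, the source of the constant 4 in the bound.
  have hnT : (n : ℝ) ≤ 2 * T + 1 := by exact_mod_cast (by omega : n ≤ 2 * T + 1)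
  set θ := Real.pi / (2 * T - 3) with hθ
  have hθT : (2 * T - 3) * θ = Real.pi := by
    rw [hθ, mul_div_cancel₀]
    linarith
  have hθ0 : 0 < θ := div_pos Real.pi_pos (by linarith)
  have hle : θ ≤ Real.pi / (n - 4) :=
    div_le_div_of_nonneg_left Real.pi_pos.le (by linarith) (by linarith)
  have hsq : θ ^ 2 ≤ Real.pi ^ 2 / ((n : ℝ) - 4) ^ 2 := by
    rw [← div_pow]; gcongr
  have hcos := Real.one_sub_sq_div_two_le_cos (x := θ)
  have hpos : ∀ k : ℕ, k + 2 ≤ T → 0 ≤ Real.sin (k * θ) := by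
    intro k hk
    have hk' : (k : ℝ) + 2 ≤ T := by exact_mod_cast hk
    have : (0 : ℝ) ≤ k := by positivity
    apply Real.sin_nonneg_of_nonneg_of_le_pi <;> nlinarith
  refine le_trans (b := 1 + 2 * Real.cos θ) (by linarith) ?_
  refine le_graphSpectralRadius (cappedLadder n)
    (x := fun i => Real.sin ((T - max ((i : ℕ) / 2) 2 : ℕ) * θ)) (i₀ := ⟨0, by omega⟩) ?_ ?_ ?_
  · exact fun i => hpos _ (by omega)
  · simp only [Nat.zero_div, zero_le, max_eq_right]
    rw [Nat.cast_sub (by omega)]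
    push_cast
    apply Real.sin_pos_of_pos_of_lt_pi <;> nlinarith
  · intro i
    refine (ladder_test_vector hT3 hθT i).trans (le_of_eq ?_)
    let f : ℕ → ℝ := fun j => Real.sin ((T - max (j / 2) 2 : ℕ) * θ)
    change ∑ j ∈ ladderNeighbors i, f j =
      ∑ j : Fin n, if (j : ℕ) ∈ ladderNeighbors i then f j else 0
    rw [← Finset.sum_range (fun j => if j ∈ ladderNeighbors i then f j else 0),
      ← Finset.sum_filter]
    symm
    refine Finset.sum_subset (fun j hj => (Finset.mem_filter.1 hj).2) fun j hj hjn => ?_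
    have : n ≤ j := by
      by_contra h
      exact hjn (Finset.mem_filter.2 ⟨Finset.mem_range.2 (by omega), hj⟩)
    simp only [f]
    rw [show T - max (j / 2) 2 = 0 by omega]
    simp

/-! ### The maximum, the limit and the refutation -/

theorem isGreatest_maxIrregularBipartiteRadius {n : ℕ} (hn : 4 ≤ n) :
    IsGreatest (graphSpectralRadius '' irregularBipartiteGraphs n 3)
      (maxIrregularBipartiteRadius n 3) := by
  have hfin : (graphSpectralRadius '' irregularBipartiteGraphs n 3).Finite :=
    (Set.toFinite _).image _
  have hne := (irregularBipartiteGraphs_nonempty hn).image graphSpectralRadius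
  exact ⟨hne.csSup_mem hfin, fun _ h => le_csSup hfin.bddAbove h⟩

theorem maxIrregularBipartiteRadius_le_maxIrregularRadius {n : ℕ} (hn : 4 ≤ n) :
    maxIrregularBipartiteRadius n 3 ≤ maxIrregularRadius n 3 :=
  csSup_le_csSup ((Set.toFinite _).image _).bddAbove
    ((irregularBipartiteGraphs_nonempty hn).image _) (Set.image_mono fun _ h => h.1)

theorem sub_maxIrregularBipartiteRadius_le {n : ℕ} (hn : 6 ≤ n) :
    3 - maxIrregularBipartiteRadius n 3 ≤ Real.pi ^ 2 / ((n : ℝ) - 4) ^ 2 := by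
  have h1 := cappedLadder_radius_ge hn
  have h2 := (isGreatest_maxIrregularBipartiteRadius (by omega : 4 ≤ n)).2
    ⟨_, cappedLadder_mem (by omega : 5 ≤ n), rfl⟩
  linarith

theorem le_sub_maxIrregularBipartiteRadius {n : ℕ} (hn : 4 ≤ n) :
    2 - 2 * Real.cos (Real.pi / ((n : ℝ) + 2)) ≤ 3 - maxIrregularBipartiteRadius n 3 := by
  obtain ⟨G, hG, hr⟩ := (isGreatest_maxIrregularBipartiteRadius hn).1
  obtain ⟨m, rfl⟩ : ∃ m, n = m + 1 := ⟨n - 1, by omega⟩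
  have h := graphSpectralRadius_le_of_mem hG
  rw [hr] at h
  push_cast
  rw [show (m : ℝ) + 1 + 2 = m + 3 by ring]
  linarith

theorem tendsto_sq_mul_sub_maxIrregularBipartiteRadius :
    Tendsto (fun n : ℕ => (n : ℝ) ^ 2 * (3 - maxIrregularBipartiteRadius n 3)) atTop
      (𝓝 (Real.pi ^ 2)) := by
  have hup : Tendsto (fun n : ℕ => Real.pi ^ 2 * ((n : ℝ) / ((n : ℝ) + (-4))) ^ 2) atTop
      (𝓝 (Real.pi ^ 2)) := by
    simpa using ((tendsto_natCast_div_add_atTop (-4 : ℝ)).pow 2).const_mul (Real.pi ^ 2)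
  have hlow : Tendsto (fun n : ℕ => (n : ℝ) ^ 2 * (2 - 2 * Real.cos (Real.pi / ((n : ℝ) + 2))))
      atTop (𝓝 (Real.pi ^ 2)) := by
    have hz : Tendsto (fun n : ℕ => Real.pi / ((n : ℝ) + 2) / 2) atTop (𝓝 0) := by
      have h : Tendsto (fun n : ℕ => (n : ℝ) + 2) atTop atTop :=
        tendsto_atTop_add_const_right _ _ tendsto_natCast_atTop_atTop
      simpa using (h.const_div_atTop Real.pi).div_const 2
    have hsinc := (Real.continuous_sinc.tendsto 0).comp hz
    rw [Real.sinc_zero] at hsinc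
    have h := ((hsinc.pow 2).mul ((tendsto_natCast_div_add_atTop (2 : ℝ)).pow 2)).const_mul
      (Real.pi ^ 2)
    simp only [one_pow, mul_one] at h
    refine h.congr fun n => ?_
    have hne : Real.pi / ((n : ℝ) + 2) / 2 ≠ 0 := by positivity
    have hn2 : (n : ℝ) + 2 ≠ 0 := by positivity
    -- The half-angle formula turns 2 - 2cos into a squared sinc, whose limit at 0 is 1.
    have hc : Real.cos (Real.pi / ((n : ℝ) + 2)) =
        1 - 2 * Real.sin (Real.pi / ((n : ℝ) + 2) / 2) ^ 2 := by
      rw [← Real.cos_two_mul_eq_one_sub]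
      ring_nf
    simp only [Function.comp, Real.sinc_of_ne_zero hne]
    rw [hc]
    have := Real.pi_pos.ne'
    field_simp
    ring
  refine tendsto_of_tendsto_of_tendsto_of_le_of_le' hlow hup ?_ ?_
  · filter_upwards [eventually_ge_atTop 4] with n hn
    exact mul_le_mul_of_nonneg_left (le_sub_maxIrregularBipartiteRadius hn) (by positivity)
  · filter_upwards [eventually_ge_atTop 6] with n hn
    refine (mul_le_mul_of_nonneg_left (sub_maxIrregularBipartiteRadius_le hn)
      (by positivity)).trans (le_of_eq ?_)
    rw [div_pow, ← sub_eq_add_neg]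
    ring

/-- Enlarging the class only lowers 3 - ρ, so the conjectured limit would force π² ≤ π²/2. -/
theorem not_liuShenWangConjecture_three : ¬ LiuShenWangConjecture 3 := by
  intro h
  have hle : Real.pi ^ 2 ≤ Real.pi ^ 2 / 2 := by
    refine le_of_tendsto_of_tendsto h
      (tendsto_sq_mul_sub_maxIrregularBipartiteRadius.div_const 2) ?_
    filter_upwards [eventually_ge_atTop 4] with n hn
    have h1 := maxIrregularBipartiteRadius_le_maxIrregularRadius hn
    have h2 : (n : ℝ) ^ 2 * (3 - maxIrregularRadius n 3) ≤
        (n : ℝ) ^ 2 * (3 - maxIrregularBipartiteRadius n 3) :=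
      mul_le_mul_of_nonneg_left (by linarith) (by positivity)
    norm_num
    linarith
  nlinarith [Real.pi_pos]

theorem theorem1 :
    (∀ n : ℕ, 4 ≤ n →
      IsGreatest (graphSpectralRadius '' irregularBipartiteGraphs n 3)
        (maxIrregularBipartiteRadius n 3)) ∧
    Filter.Tendsto (fun n : ℕ => (n : ℝ) ^ 2 * (3 - maxIrregularBipartiteRadius n 3))
      Filter.atTop (nhds (Real.pi ^ 2)) ∧
    ¬ LiuShenWangConjecture 3 :=
  ⟨fun _ hn => isGreatest_maxIrregularBipartiteRadius hn,
    tendsto_sq_mul_sub_maxIrregularBipartiteRadius, not_liuShenWangConjecture_three⟩
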